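/- **Setting.** Let $O=(A,Z,W,X,Y)$ with $A,Y\in\mathbb R$, $Z\in\mathbb R^{d_z}$, $W\in\mathbb R^{d_w}$, $X\in\mathbb R^{d_x}$ have law $P^0$ with Lebesgue density $p^0$, and fix a treatment level $a$ at which $p^0(a,\cdot)$ is integrable and overlap holds: $p^0(a\mid W,X)>0$ almost surely. For a law $P$ with density $p$, an *outcome bridge function* at $a$ is a function $h_0(a,\cdot,\cdot;P)$, square integrable with respect to $p(a,z,w,x,y)\,dz\,dw\,dx\,dy$, with $E_P[Y-h_0(a,W,X;P)\mid A=a,Z,X]=0$. A *treatment bridge function* of $P^0$ at $a$ is a function $q_0(a,\cdot,\cdot)$, square integrable in the same sense, with $E[q_0(a,Z,X)-1/p^0(a\mid W,X)\mid A=a,W,X]=0$. Assume that both exist for $P^0$ and that $y$ is square integrable with respect to $p^0(a,z,w,x,y)\,dz\,dw\,dx\,dy$. Write $h_0=h_0(\cdot\,;P^0)$. The parameter is the functional $$\beta(a;P)=\int h_0(a,w,x;P)\,dP(w,x),\qquad \beta(a)=\beta(a;P^0),$$ which is the expression of $E[Y(a)]$ through the observed law in proximal causal inference. Let $K$ be a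 bounded symmetric kernel on $\mathbb R$ with $\int K=1$, $\int uK(u)\,du=0$ and $\int u^2|K(u)|\,du<\infty$, and let $K_h(u)=K(u/h)/h$, extended to vectors as a product kernel. Fix an observation $O=(A,Z,W,X,Y)$. For $h>0$ let $P^h$ have the density $$p^h(o)=K_h(O-o)\,\mathbf 1\{p^0(o)>h\},$$ and consider the submodel $P^{\varepsilon h}=(1-\varepsilon)P^0+\varepsilon P^h$ with $\varepsilon\ge 0$. (The function $p^h$ is used as it stands, without normalization.) The model is nonparametric: it restricts the law only through the existence of bridge functions. The submodel is assumed to stay in it, regularly: for all small $h$, $P^{\varepsilon h}$ has an outcome bridge function at $a$ for all small $\varepsilon>0$, and $h_0(a,\cdot\,;P^{\varepsilon h})\to h_0(a,\cdot)$ as $\varepsilon\downarrow0$ in $L^2(p^0(a,z,w,x,y)\,dz\,dw\,dx\,dy)$. Let $p^0$ be positive and continuous at $(A,Z,W,X,Y)$ and at $(a,Z,W,X,Y)$, let $h_0(a,\cdot)$ and $q_0(a,\cdot)$ be continuous at $(W,X)$ and at $(Z,X)$, and write $f(z,w,x,y)=(y-h_0(a,w,x))\,q_0(a,z,x)$ and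 $V=(Z,W,X,Y)$. Assume that $g(V-hu)K(u)$ is dominated, for all small $h$, by one integrable function of $u$, both for $g=f$ and for $g=h_0(a,\cdot)$ (here $K(u)$ is the product kernel). **Theorem.** For all small $h>0$ the Gateaux derivative $D_h=\left.\frac{\partial}{\partial\varepsilon}\beta(a;P^{\varepsilon h})\right|_{\varepsilon=0}$ (a right derivative, as $\varepsilon\ge0$) exists, and $$\lim_{h\to0}D_h=(Y-h_0(a,W,X))\,q_0(a,Z,X)\,\lim_{h\to0}K_h(A-a)+h_0(a,W,X)-\beta(a)$$ whenever the finite limit $\lim_{h\to0}K_h(A-a)$ exists. In every case, including that of divergent $K_h(A-a)$ (for example $A=a$, $K(0)\ne0$), $D_h$ is given by the kernel doubly robust form: as $h\to0$, $$D_h=(Y-h_0(a,W,X))\,q_0(a,Z,X)\,K_h(A-a)+h_0(a,W,X)-\beta(a)+o\bigl(1+|K_h(A-a)|\bigr).$$ The remainder is $o(1)$ if moreover $f$ is differentiable at $V$ and $f(V-hu)(1+\|u\|)K(u)$ is dominated, for all small $h$, by one integrable function of $u$. -/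

import Mathlib

open MeasureTheory Filter Topology Set

noncomputable section

namespace Proximal

/-- Values `(z, w, x, y)` of the treatment proxy, the outcome proxy, the covariates and the outcome. -/
abbrev Rest (dz dw dx : ℕ) : Type :=
  (Fin dz → ℝ) × (Fin dw → ℝ) × (Fin dx → ℝ) × ℝ

/-- Values `o = (a, z, w, x, y)` of the observed vector; the first entry is the treatment. -/
abbrev Obs (dz dw dx : ℕ) : Type := ℝ × Rest dz dw dx

variable {dz dw dx : ℕ}

/-- `p` is a Lebesgue probability density on the observation space. -/
structure IsDensity (p : Obs dz dw dx → ℝ) : Prop where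
  measurable : Measurable p
  nonneg : ∀ o, 0 ≤ p o
  integrable : Integrable p
  integral_eq_one : ∫ o, p o = 1

/-- The marginal density `p(a, z, x)`. -/
def margAZX (p : Obs dz dw dx → ℝ) (a : ℝ) (z : Fin dz → ℝ) (x : Fin dx → ℝ) : ℝ :=
  ∫ s : (Fin dw → ℝ) × ℝ, p (a, z, s.1, x, s.2)

/-- The marginal density `p(a, w, x)`. -/
def margAWX (p : Obs dz dw dx → ℝ) (a : ℝ) (w : Fin dw → ℝ) (x : Fin dx → ℝ) : ℝ :=
  ∫ s : (Fin dz → ℝ) × ℝ, p (a, s.1, w, x, s.2)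

/-- The marginal density `p(w, x)`. -/
def margWX (p : Obs dz dw dx → ℝ) (w : Fin dw → ℝ) (x : Fin dx → ℝ) : ℝ :=
  ∫ s : ℝ × (Fin dz → ℝ) × ℝ, p (s.1, s.2.1, w, x, s.2.2)

/-- The conditional density `p(a | w, x)` of the treatment (the policy). -/
def policy (p : Obs dz dw dx → ℝ) (a : ℝ) (w : Fin dw → ℝ) (x : Fin dx → ℝ) : ℝ :=
  margAWX p a w x / margWX p w x

/-- The slice `p(a, ·)` as a measure on `(z, w, x, y)`: the law of `(Z, W, X, Y)` given `A = a`,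
times the marginal density of `A` at `a`. -/
def slice (p : Obs dz dw dx → ℝ) (a : ℝ) : Measure (Rest dz dw dx) :=
  volume.withDensity (fun v => ENNReal.ofReal (p (a, v)))

/-- `h(a, ·, ·)` is a square-integrable outcome bridge function at the treatment level `a`:
`E[Y - h(a, W, X) | A = a, Z = z, X = x] = 0`, the conditional expectation being the integral against
the conditional density `p(w, y | a, z, x)`. -/
structure IsOutcomeBridge (p : Obs dz dw dx → ℝ) (a : ℝ)
    (h : (Fin dw → ℝ) → (Fin dx → ℝ) → ℝ) : Prop where
  measurable : Measurable (fun s : (Fin dw → ℝ) × (Fin dx → ℝ) => h s.1 s.2)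
  memLp : MemLp (fun v : Rest dz dw dx => h v.2.1 v.2.2.1) 2 (slice p a)
  moment_eq : ∀ᵐ t : (Fin dz → ℝ) × (Fin dx → ℝ), 0 < margAZX p a t.1 t.2 →
    ∫ s : (Fin dw → ℝ) × ℝ,
      (s.2 - h s.1 t.2) * (p (a, t.1, s.1, t.2, s.2) / margAZX p a t.1 t.2) = 0

/-- `q(a, ·, ·)` is a square-integrable treatment bridge function at the treatment level `a`:
`E[q(a, Z, X) - 1 / p(a | W, X) | A = a, W = w, X = x] = 0`, the conditional expectation being the
integral against the conditional density `p(z, y | a, w, x)`. -/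
structure IsTreatmentBridge (p : Obs dz dw dx → ℝ) (a : ℝ)
    (q : (Fin dz → ℝ) → (Fin dx → ℝ) → ℝ) : Prop where
  measurable : Measurable (fun s : (Fin dz → ℝ) × (Fin dx → ℝ) => q s.1 s.2)
  memLp : MemLp (fun v : Rest dz dw dx => q v.1 v.2.2.1) 2 (slice p a)
  moment_eq : ∀ᵐ t : (Fin dw → ℝ) × (Fin dx → ℝ), 0 < margAWX p a t.1 t.2 →
    ∫ s : (Fin dz → ℝ) × ℝ,
      (q s.1 t.2 - 1 / policy p a t.1 t.2) *
        (p (a, s.1, t.1, t.2, s.2) / margAWX p a t.1 t.2) = 0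

/-- Overlap at `a`: `p(a | W, X) > 0` almost surely. -/
def Overlap (p : Obs dz dw dx → ℝ) (a : ℝ) : Prop :=
  ∀ᵐ t : (Fin dw → ℝ) × (Fin dx → ℝ), 0 < margWX p t.1 t.2 → 0 < policy p a t.1 t.2

/-- The parameter `β(a; P) = E_P[h₀(a, W, X; P)]`, for a rule `h₀` that assigns to a density `p`
its outcome bridge function `h₀ p`. -/
def beta (h₀ : (Obs dz dw dx → ℝ) → ℝ → (Fin dw → ℝ) → (Fin dx → ℝ) → ℝ)
    (a : ℝ) (p : Obs dz dw dx → ℝ) : ℝ :=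
  ∫ o : Obs dz dw dx, h₀ p a o.2.2.1 o.2.2.2.1 * p o

/-- A bounded symmetric kernel of second order. -/
structure IsKernel (K : ℝ → ℝ) : Prop where
  measurable : Measurable K
  bounded : ∃ C, ∀ u, |K u| ≤ C
  symm : ∀ u, K (-u) = K u
  integrable : Integrable K
  integral_eq_one : ∫ u, K u = 1
  integral_mul_eq_zero : ∫ u, u * K u = 0
  integrable_sq_mul : Integrable (fun u => u ^ 2 * K u)

/-- The rescaled kernel `K_b(u) = K(u / b) / b` with bandwidth `b`. -/
def scaled (K : ℝ → ℝ) (b u : ℝ) : ℝ := 1 / b * K (u / b)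

/-- The product kernel on `(z, w, x, y)`. -/
def restKernel (K : ℝ → ℝ) (v : Rest dz dw dx) : ℝ :=
  (∏ i, K (v.1 i)) * (∏ i, K (v.2.1 i)) * (∏ i, K (v.2.2.1 i)) * K v.2.2.2

/-- The product kernel on `(a, z, w, x, y)`. -/
def obsKernel (K : ℝ → ℝ) (o : Obs dz dw dx) : ℝ := K o.1 * restKernel K o.2

/-- The density of the perturbation with centre `O` and bandwidth `b`:
`o ↦ K_b(O - o) 1(p⁰(o) > b)`. -/
def pertDensity (p : Obs dz dw dx → ℝ) (K : ℝ → ℝ) (O : Obs dz dw dx) (b : ℝ) :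
    Obs dz dw dx → ℝ :=
  indicator {o | b < p o} (fun o => obsKernel (scaled K b) (O - o))

/-- The submodel `(1 - ε) P⁰ + ε P^b`, through densities. -/
def submodel (p : Obs dz dw dx → ℝ) (K : ℝ → ℝ) (O : Obs dz dw dx) (b ε : ℝ) :
    Obs dz dw dx → ℝ :=
  fun o => (1 - ε) * p o + ε * pertDensity p K O b o

/-- The function `(z, w, x, y) ↦ (y - h(w, x)) q(z, x)`. -/
def weightedResidual (h : (Fin dw → ℝ) → (Fin dx → ℝ) → ℝ) (q : (Fin dz → ℝ) → (Fin dx → ℝ) → ℝ)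
    (v : Rest dz dw dx) : ℝ :=
  (v.2.2.2 - h v.2.1 v.2.2.1) * q v.1 v.2.2.1

/-- `g(V - b u) (1 + ‖u‖)^r K(u)` is dominated by one integrable function of `u`, for all small
bandwidths `b`. -/
def KernelDominated (K : ℝ → ℝ) (r : ℕ) (V : Rest dz dw dx) (g : Rest dz dw dx → ℝ) : Prop :=
  ∃ B : Rest dz dw dx → ℝ, Integrable B ∧ ∀ᶠ b in 𝓝[>] (0 : ℝ), ∀ u,
    |g (V - b • u) * (1 + ‖u‖) ^ r * restKernel K u| ≤ B u

/-- The summand of the kernel doubly robust estimator of `β(a)` at the observation `o`: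
`(Y - h(a, W, X)) q(a, Z, X) K_b(A - a) + h(a, W, X)`. -/
def kernelDR (K : ℝ → ℝ) (h : (Fin dw → ℝ) → (Fin dx → ℝ) → ℝ)
    (q : (Fin dz → ℝ) → (Fin dx → ℝ) → ℝ) (a b : ℝ) (o : Obs dz dw dx) : ℝ :=
  weightedResidual h q o.2 * scaled K b (o.1 - a) + h o.2.2.1 o.2.2.2.1

end Proximal

end

/-! The derivative needs neither differentiability nor uniqueness of the bridge function along the
submodel: the moment equations alone yield an exact identity. Let `k` be the bridge of `(1 - ε) p +
ε r`, let `h` be that of `p`, and put `d = k - h`. Testing the moment equation of `k` against `q`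
gives (1 - ε) ∫ (y - k) q p(a,·) + ε ∫ (y - k) q r(a,·) = 0. The moment equation of `h` turns the
first integral into -∫ d q p(a,·), and the treatment bridge turns ∫ d q p(a,·) into ∫ d p. The
unknown first-order change ∫ d p of the bridge is thereby expressed through `r`, and the difference
quotient of β equals ∫ (y - h) q r(a,·) + ∫ h r - ∫ h p + (∫ d r - ∫ d q r(a,·)).

The truncation in the perturbation gives |r| ≤ M p for fixed bandwidth. By Cauchy–Schwarz and the
treatment bridge, the last bracket is at most 2 M ‖d‖ ‖q‖ in L² of the slice, so it vanishes with
`ε` (`abs_quotient_sub_le`, `hasDerivWithinAt_integral_bridge`).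

For the kernel perturbation the derivative is J(b) K_b(A - a) + I(b) - β(a), where J and I are
truncated kernel smoothers of the weighted residual and of `h`. They converge to the values at the
observation (`tendsto_integral_truncated`). Since K_b(A - a) may grow like 1/b, the o(1) remainder
requires J(b) - f(V) = o(b), which holds at a point of differentiability because the kernel is even
(`tendsto_integral_truncated_sub_div`). -/

namespace Proximal

/-! ### Truncated kernel smoothers at a point. -/

section Mollifier

lemma abs_indicator_le {E : Type*} (s : Set E) (g : E → ℝ) (v : E) : |indicator s g v| ≤ |g v| := by
  by_cases h : v ∈ s <;> simp [h]

variable {E : Type*} [NormedAddCommGroup E] [NormedSpace ℝ E]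

lemma tendsto_sub_smul (V u : E) : Tendsto (fun b : ℝ => V - b • u) (𝓝[>] 0) (𝓝 V) := by
  have : ContinuousAt (fun b : ℝ => V - b • u) 0 := by fun_prop
  have h := this.tendsto
  simp only [zero_smul, sub_zero] at h
  exact h.mono_left nhdsWithin_le_nhds

/-- The truncation level tends to 0 while `ρ` stays near a positive value, so for each fixed `u` the
truncation is eventually inactive. This is not uniform in `u`, hence the use of dominated
convergence below. -/
lemma eventually_lt_apply_sub_smul {ρ : E → ℝ} {V : E} (hρ : ContinuousAt ρ V) (hpos : 0 < ρ V)
    (u : E) : ∀ᶠ b in 𝓝[>] (0 : ℝ), b < ρ (V - b • u) := by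
  have h1 := hρ.tendsto.comp (tendsto_sub_smul V u)
  have h2 : Tendsto (fun b : ℝ => b) (𝓝[>] 0) (𝓝 0) := nhdsWithin_le_nhds
  exact h2.eventually_lt h1 hpos

variable [MeasurableSpace E] [BorelSpace E] {μ : Measure E}

/-- Integrating against a rescaled kernel, after the substitution `v = V - b u`. -/
lemma integral_mul_comp_smul_sub [FiniteDimensional ℝ E] [μ.IsAddHaarMeasure]
    (φ κ : E → ℝ) (V : E) {b : ℝ} (hb : 0 < b) :
    ∫ v, φ v * ((b ^ Module.finrank ℝ E)⁻¹ * κ (b⁻¹ • (V - v))) ∂μ =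
      ∫ u, φ (V - b • u) * κ u ∂μ := by
  have h1 := integral_sub_left_eq_self
    (fun v => φ (V - v) * ((b ^ Module.finrank ℝ E)⁻¹ * κ (b⁻¹ • v))) μ V
  simp only [sub_sub_cancel] at h1
  rw [h1]
  have h2 := Measure.integral_comp_smul μ (fun v => φ (V - v) * κ (b⁻¹ • v)) b
  simp only [smul_smul, inv_mul_cancel₀ hb.ne', one_smul] at h2
  rw [h2, abs_of_pos (by positivity), smul_eq_mul, ← integral_const_mul]
  exact integral_congr_ae (Eventually.of_forall fun v => by dsimp only; ring)

lemma aestronglyMeasurable_truncated {g κ ρ : E → ℝ} (hg : Measurable g) (hκ : Measurable κ)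
    (hρ : Measurable ρ) (V : E) (b : ℝ) :
    AEStronglyMeasurable
      (fun u => indicator {v | b < ρ v} g (V - b • u) * κ u) μ := by
  have h1 : Measurable (indicator {v | b < ρ v} g) :=
    hg.indicator (measurableSet_lt measurable_const hρ)
  exact ((h1.comp (by fun_prop)).mul hκ).aestronglyMeasurable

/-- A truncated kernel smoother reproduces the value at a point of continuity. -/
lemma tendsto_integral_truncated {g κ ρ : E → ℝ} {V : E} (hg : Measurable g) (hκ : Measurable κ)
    (hρ : Measurable ρ) (hgV : ContinuousAt g V) (hρV : ContinuousAt ρ V) (hpos : 0 < ρ V)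
    (hκ1 : ∫ u, κ u ∂μ = 1) {B : E → ℝ} (hB : Integrable B μ)
    (hdom : ∀ᶠ b in 𝓝[>] (0 : ℝ), ∀ u, |g (V - b • u) * κ u| ≤ B u) :
    Tendsto (fun b => ∫ u, indicator {v | b < ρ v} g (V - b • u) * κ u ∂μ) (𝓝[>] 0)
      (𝓝 (g V)) := by
  have hlim : g V = ∫ u, g V * κ u ∂μ := by rw [integral_const_mul, hκ1, mul_one]
  rw [hlim]
  refine tendsto_integral_filter_of_dominated_convergence (μ := μ) B
    (Eventually.of_forall fun b => aestronglyMeasurable_truncated hg hκ hρ V b) ?_ hB ?_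
  · filter_upwards [hdom] with b hb
    refine Eventually.of_forall fun u => ?_
    rw [Real.norm_eq_abs, abs_mul]
    refine le_trans ?_ (hb u)
    rw [abs_mul]
    exact mul_le_mul_of_nonneg_right (abs_indicator_le _ _ _) (abs_nonneg _)
  · refine Eventually.of_forall fun u => ?_
    have h1 := (hgV.tendsto.comp (tendsto_sub_smul V u)).mul_const (κ u)
    refine h1.congr' ?_
    filter_upwards [eventually_lt_apply_sub_smul hρV hpos u] with b hb
    simp [indicator, hb]

/-- At a point of differentiability, a truncated smoother with an even kernel has error `o(b)`. -/
lemma tendsto_integral_truncated_sub_div {g κ ρ : E → ℝ} {V : E} (hg : Measurable g)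
    (hκ : Measurable κ) (hρ : Measurable ρ) (hgV : DifferentiableAt ℝ g V)
    (hρV : ContinuousAt ρ V) (hpos : 0 < ρ V) [FiniteDimensional ℝ E] [μ.IsAddHaarMeasure]
    (hκi : Integrable κ μ) (hκ1 : ∫ u, κ u ∂μ = 1) (heven : ∀ u, κ (-u) = κ u)
    (hmom : Integrable (fun u => ‖u‖ * |κ u|) μ)
    {B : E → ℝ} (hB : Integrable B μ)
    (hdom : ∀ᶠ b in 𝓝[>] (0 : ℝ), ∀ u, |g (V - b • u) * (1 + ‖u‖) * κ u| ≤ B u) :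
    Tendsto (fun b => ((∫ u, indicator {v | b < ρ v} g (V - b • u) * κ u ∂μ) - g V) / b)
      (𝓝[>] 0) (𝓝 0) := by
  have hdom0 : ∀ (b : ℝ) (u : E), |g (V - b • u) * (1 + ‖u‖) * κ u| ≤ B u →
      |g (V - b • u)| * |κ u| ≤ B u ∧ |g (V - b • u)| * (‖u‖ * |κ u|) ≤ B u := by
    intro b u h
    rw [abs_mul, abs_mul, abs_of_nonneg (by positivity : 0 ≤ 1 + ‖u‖)] at h
    have h1 : 0 ≤ |g (V - b • u)| * |κ u| := by positivity
    have h2 : 0 ≤ |g (V - b • u)| * (‖u‖ * |κ u|) := by positivity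
    constructor <;> nlinarith
  have hB0 : ∀ u, 0 ≤ B u := by
    obtain ⟨b, hb⟩ := hdom.exists
    exact fun u => (abs_nonneg _).trans (hb u)
  -- The pointwise limit of the difference quotients is an odd function of `u`, so the substitution
  -- `u ↦ -u` shows that its integral vanishes.
  have hlim : ∫ u, -(fderiv ℝ g V u) * κ u ∂μ = 0 := by
    have h1 := Measure.integral_comp_smul μ (fun u => -(fderiv ℝ g V u) * κ u) (-1)
    simp only [neg_smul, one_smul, map_neg, heven, neg_neg, abs_inv, abs_pow, abs_neg, abs_one,
      one_pow, inv_one] at h1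
    have h2 : ∫ u, -(fderiv ℝ g V u) * κ u ∂μ = -∫ u, (fderiv ℝ g V u) * κ u ∂μ := by
      rw [← integral_neg]; simp only [neg_mul]
    linarith
  obtain ⟨C, hC⟩ := hgV.isBigO_sub.bound
  -- Within `δ` of `V` the increments of `g` are at most linear and `ρ` exceeds `ρ V / 2`, so no
  -- truncation occurs there once `b < ρ V / 2`.
  obtain ⟨δ, hδ, hball⟩ := Metric.eventually_nhds_iff.1
    (hC.and (hρV.eventually_const_lt (half_lt_self hpos)))
  have hsmall : ∀ᶠ b in 𝓝[>] (0 : ℝ), b < ρ V / 2 :=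
    nhdsWithin_le_nhds (eventually_lt_nhds (half_pos hpos))
  have key : Tendsto (fun b => ∫ u,
      (indicator {v | b < ρ v} g (V - b • u) - g V) / b * κ u ∂μ) (𝓝[>] 0) (𝓝 0) := by
    refine Eq.subst (motive := fun l => Tendsto _ (𝓝[>] (0 : ℝ)) (𝓝 l)) hlim ?_
    refine tendsto_integral_filter_of_dominated_convergence
      -- The first term dominates where `b‖u‖ < δ`, by the linear bound. The second dominates where
      -- `b‖u‖ ≥ δ`: there `1 / b ≤ ‖u‖ / δ`, which trades the division by `b` for one moment of the
      -- kernel.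
      (fun u => |C| * (‖u‖ * |κ u|) + δ⁻¹ * (B u + |g V| * (‖u‖ * |κ u|))) ?_ ?_ ?_ ?_
    · refine Eventually.of_forall fun b => ?_
      have h1 : Measurable (indicator {v | b < ρ v} g) :=
        hg.indicator (measurableSet_lt measurable_const hρ)
      exact ((((h1.comp (by fun_prop)).sub_const _).div_const _).mul hκ).aestronglyMeasurable
    · filter_upwards [hdom, hsmall, self_mem_nhdsWithin] with b hb hbs hb0
      have hb0 : 0 < b := hb0
      refine Eventually.of_forall fun u => ?_
      rw [Real.norm_eq_abs, abs_mul, abs_div, abs_of_pos hb0]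
      have hn : ‖b • u‖ = b * ‖u‖ := by rw [norm_smul, Real.norm_eq_abs, abs_of_pos hb0]
      have hk0 : 0 ≤ ‖u‖ * |κ u| := by positivity
      have hd : dist (V - b • u) V = b * ‖u‖ := by rw [dist_eq_norm, ← hn]; simp
      by_cases hu : b * ‖u‖ < δ
      · obtain ⟨h1, h2⟩ := hball (hd.trans_lt hu)
        have hmem : V - b • u ∈ {v | b < ρ v} := hbs.trans h2
        rw [indicator_of_mem hmem]
        have h3 : |g (V - b • u) - g V| ≤ |C| * (b * ‖u‖) := by
          rw [← Real.norm_eq_abs]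
          refine h1.trans ?_
          rw [← dist_eq_norm, hd]
          gcongr
          exact le_abs_self C
        have h4 : |g (V - b • u) - g V| / b ≤ |C| * ‖u‖ := by
          rw [div_le_iff₀ hb0]; linarith
        calc |g (V - b • u) - g V| / b * |κ u| ≤ |C| * ‖u‖ * |κ u| := by gcongr
          _ = |C| * (‖u‖ * |κ u|) + 0 := by ring
          _ ≤ _ := by
            gcongr
            have := hB0 u
            positivity
      · have hu : δ ≤ b * ‖u‖ := not_lt.1 hu
        have h1 : 1 / b ≤ δ⁻¹ * ‖u‖ := by
          rw [div_le_iff₀ hb0, inv_mul_eq_div, div_mul_eq_mul_div, le_div_iff₀ hδ]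
          linarith
        have h2 : |indicator {v | b < ρ v} g (V - b • u) - g V| ≤ |g (V - b • u)| + |g V| :=
          (abs_sub _ _).trans (add_le_add_left (abs_indicator_le _ _ _) _)
        calc |indicator {v | b < ρ v} g (V - b • u) - g V| / b * |κ u|
            = |indicator {v | b < ρ v} g (V - b • u) - g V| * (1 / b) * |κ u| := by ring
          _ ≤ (|g (V - b • u)| + |g V|) * (δ⁻¹ * ‖u‖) * |κ u| := by gcongr
          _ = 0 + δ⁻¹ * (|g (V - b • u)| * (‖u‖ * |κ u|) + |g V| * (‖u‖ * |κ u|)) := by ring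
          _ ≤ _ := by
            gcongr
            · positivity
            · exact (hdom0 b u (hb u)).2
    · exact (hmom.const_mul _).add ((hB.add (hmom.const_mul _)).const_mul _)
    · refine Eventually.of_forall fun u => ?_
      refine Tendsto.mul_const _ ?_
      have h1 : HasDerivAt (fun b : ℝ => g (V - b • u)) (-(fderiv ℝ g V u)) 0 := by
        have h2 : HasDerivAt (fun b : ℝ => V - b • u) (-u) 0 := by
          simpa using ((hasDerivAt_id (0 : ℝ)).smul_const u).const_sub V
        have h3 : HasFDerivAt g (fderiv ℝ g V) (V - (0 : ℝ) • u) := by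
          simpa using hgV.hasFDerivAt
        simpa [Function.comp_def] using! h3.comp_hasDerivAt (0 : ℝ) h2
      have h4 := (hasDerivAt_iff_tendsto_slope.1 h1).mono_left
        (nhdsWithin_mono (0 : ℝ) (fun b (hb : (0 : ℝ) < b) => hb.ne'))
      refine h4.congr' ?_
      filter_upwards [eventually_lt_apply_sub_smul hρV hpos u] with b hb
      simp [indicator, hb, slope_def_field]
  refine key.congr' ?_
  filter_upwards [hdom] with b hb
  have hi : Integrable (fun u => indicator {v | b < ρ v} g (V - b • u) * κ u) μ := by
    refine hB.mono' (aestronglyMeasurable_truncated hg hκ hρ V b)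
      (Eventually.of_forall fun u => ?_)
    rw [Real.norm_eq_abs, abs_mul]
    refine le_trans ?_ (hdom0 b u (hb u)).1
    exact mul_le_mul_of_nonneg_right (abs_indicator_le _ _ _) (abs_nonneg _)
  have h1 : g V = ∫ u, g V * κ u ∂μ := by rw [integral_const_mul, hκ1, mul_one]
  conv_rhs => rw [h1]
  rw [← integral_sub hi (hκi.const_mul _), ← integral_div]
  exact integral_congr_ae (Eventually.of_forall fun u => by dsimp only; ring)

end Mollifier

/-! ### Mass, symmetry, scaling and moments of product kernels. -/

section Kernel

variable {dz dw dx : ℕ}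

lemma measurable_restKernel {K : ℝ → ℝ} (hK : Measurable K) :
    Measurable (restKernel K : Rest dz dw dx → ℝ) := by
  unfold restKernel
  refine ((Measurable.mul ?_ ?_).mul ?_).mul ?_
  · exact Finset.measurable_prod _ fun i _ => hK.comp (by fun_prop)
  · exact Finset.measurable_prod _ fun i _ => hK.comp (by fun_prop)
  · exact Finset.measurable_prod _ fun i _ => hK.comp (by fun_prop)
  · exact hK.comp (by fun_prop)

lemma measurable_obsKernel {K : ℝ → ℝ} (hK : Measurable K) :
    Measurable (obsKernel K : Obs dz dw dx → ℝ) :=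
  (hK.comp measurable_fst).mul ((measurable_restKernel hK).comp measurable_snd)

lemma restKernel_eq_mul (K : ℝ → ℝ) : (restKernel K : Rest dz dw dx → ℝ) =
    fun v => (∏ i, K (v.1 i)) * ((∏ i, K (v.2.1 i)) * ((∏ i, K (v.2.2.1 i)) * K v.2.2.2)) := by
  ext v; simp only [restKernel]; ring

lemma integrable_restKernel {K : ℝ → ℝ} (hK : Integrable K) :
    Integrable (restKernel K : Rest dz dw dx → ℝ) := by
  have hprod : ∀ d : ℕ, Integrable (fun v : Fin d → ℝ => ∏ i, K (v i)) := fun d =>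
    Integrable.fintype_prod (fun _ => hK)
  rw [restKernel_eq_mul]
  exact (hprod dz).mul_prod ((hprod dw).mul_prod ((hprod dx).mul_prod hK))

lemma integral_restKernel {K : ℝ → ℝ} (h1 : ∫ u, K u = 1) :
    ∫ v, (restKernel K : Rest dz dw dx → ℝ) v = 1 := by
  have hprod : ∀ d : ℕ, ∫ v : Fin d → ℝ, ∏ i, K (v i) = 1 := fun d => by
    rw [volume_pi, integral_fintype_prod_eq_pow, h1, one_pow]
  rw [restKernel_eq_mul]
  simp only [Measure.volume_eq_prod]
  rw [integral_prod_mul (fun v : Fin dz → ℝ => ∏ i, K (v i))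
      (fun v : (Fin dw → ℝ) × (Fin dx → ℝ) × ℝ =>
        (∏ i, K (v.1 i)) * ((∏ i, K (v.2.1 i)) * K v.2.2)),
    integral_prod_mul (fun v : Fin dw → ℝ => ∏ i, K (v i))
      (fun v : (Fin dx → ℝ) × ℝ => (∏ i, K (v.1 i)) * K v.2),
    integral_prod_mul (fun v : Fin dx → ℝ => ∏ i, K (v i)) K, hprod, hprod, hprod, h1]
  norm_num

lemma integral_obsKernel {K : ℝ → ℝ} (h1 : ∫ u, K u = 1) :
    ∫ v, (obsKernel K : Obs dz dw dx → ℝ) v = 1 := by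
  simp only [obsKernel, Measure.volume_eq_prod ℝ (Rest dz dw dx)]
  rw [integral_prod_mul, h1, integral_restKernel h1, one_mul]

lemma restKernel_neg {K : ℝ → ℝ} (hK : ∀ u, K (-u) = K u) (v : Rest dz dw dx) :
    restKernel K (-v) = restKernel K v := by
  simp [restKernel, hK]

lemma restKernel_scaled (K : ℝ → ℝ) (b : ℝ) (v : Rest dz dw dx) :
    restKernel (scaled K b) v =
      (b ^ Module.finrank ℝ (Rest dz dw dx))⁻¹ * restKernel K (b⁻¹ • v) := by
  simp only [restKernel, scaled, Finset.prod_mul_distrib, Module.finrank_prod, Prod.smul_fst,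
    Prod.smul_snd, Pi.smul_apply, smul_eq_mul, div_eq_inv_mul, Finset.prod_const,
    Finset.card_univ, Fintype.card_fin, Module.finrank_pi, Module.finrank_self, mul_one]
  rw [← inv_pow]
  ring

lemma obsKernel_scaled (K : ℝ → ℝ) (b : ℝ) (v : Obs dz dw dx) :
    obsKernel (scaled K b) v =
      (b ^ Module.finrank ℝ (Obs dz dw dx))⁻¹ * obsKernel K (b⁻¹ • v) := by
  have h1 : Module.finrank ℝ (Obs dz dw dx) = 1 + Module.finrank ℝ (Rest dz dw dx) := by
    rw [Module.finrank_prod, Module.finrank_self]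
  rw [obsKernel, restKernel_scaled, h1]
  simp only [obsKernel, scaled, Prod.smul_fst, Prod.smul_snd, smul_eq_mul, div_eq_inv_mul,
    pow_add, pow_one, mul_inv]
  ring

lemma one_add_norm_le_prod {d : ℕ} (v : Fin d → ℝ) : 1 + ‖v‖ ≤ ∏ i, (1 + |v i|) := by
  have h1 : ∀ s : Finset (Fin d), 1 ≤ ∏ i ∈ s, (1 + |v i|) := fun s =>
    Finset.one_le_prod fun i _ => by linarith [abs_nonneg (v i)]
  have h2 : ‖v‖ ≤ ∏ i, (1 + |v i|) - 1 := by
    refine (pi_norm_le_iff_of_nonneg (by linarith [h1 Finset.univ])).2 fun i => ?_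
    rw [← Finset.mul_prod_erase _ _ (Finset.mem_univ i), Real.norm_eq_abs]
    nlinarith [h1 (Finset.univ.erase i), abs_nonneg (v i)]
  linarith

lemma one_add_norm_prod_le {E F : Type*} [NormedAddCommGroup E] [NormedAddCommGroup F]
    {v : E × F} {s t : ℝ} (hs : 1 + ‖v.1‖ ≤ s) (ht : 1 + ‖v.2‖ ≤ t) : 1 + ‖v‖ ≤ s * t := by
  have h1 := norm_nonneg v.1
  have h2 := norm_nonneg v.2
  rcases max_cases ‖v.1‖ ‖v.2‖ with h | h <;> rw [Prod.norm_def, h.1] <;> nlinarith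

/-- The weight `1 + ‖u‖` is at most the product of the coordinate weights `1 + |uᵢ|`, which reduces
the claim to one dimension, where `1 + |t| ≤ 2 + t ^ 2` and the second moment of `K` suffices. -/
lemma integrable_norm_mul_restKernel {K : ℝ → ℝ} (hK : IsKernel K) :
    Integrable (fun u : Rest dz dw dx => ‖u‖ * |restKernel K u|) := by
  have h1 : Integrable (fun t => (1 + |t|) * |K t|) := by
    refine ((hK.integrable.norm.const_mul 2).add hK.integrable_sq_mul.norm).mono'
      ((Measurable.aestronglyMeasurable (by fun_prop)).mul
        hK.integrable.aestronglyMeasurable.norm) (Eventually.of_forall fun t => ?_)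
    simp only [Pi.add_apply, Real.norm_eq_abs, abs_mul, abs_abs, abs_pow, sq_abs]
    rw [abs_of_nonneg (by positivity : 0 ≤ 1 + |t|), ← add_mul]
    refine mul_le_mul_of_nonneg_right ?_ (abs_nonneg _)
    nlinarith [sq_nonneg (|t| - 1), sq_abs t]
  refine (integrable_restKernel (dz := dz) (dw := dw) (dx := dx) h1).mono'
    ((Measurable.aestronglyMeasurable (by fun_prop)).mul
      (measurable_restKernel hK.measurable).aestronglyMeasurable.norm)
    (Eventually.of_forall fun u => ?_)
  have h2 : 1 + ‖u‖ ≤ (∏ i, (1 + |u.1 i|)) * ((∏ i, (1 + |u.2.1 i|)) *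
      ((∏ i, (1 + |u.2.2.1 i|)) * (1 + |u.2.2.2|))) :=
    one_add_norm_prod_le (one_add_norm_le_prod _) <|
      one_add_norm_prod_le (one_add_norm_le_prod _) <|
        one_add_norm_prod_le (one_add_norm_le_prod _) le_rfl
  rw [Real.norm_eq_abs, abs_of_nonneg (by positivity)]
  calc ‖u‖ * |restKernel K u| ≤ (1 + ‖u‖) * |restKernel K u| := by gcongr; linarith
    _ ≤ _ := mul_le_mul_of_nonneg_right h2 (abs_nonneg _)
    _ = _ := by
      simp only [restKernel, Finset.prod_mul_distrib, abs_mul, Finset.abs_prod]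
      ring

lemma exists_abs_obsKernel_le {K : ℝ → ℝ} {C : ℝ} (hK : ∀ u, |K u| ≤ C) :
    ∃ C', ∀ o : Obs dz dw dx, |obsKernel K o| ≤ C' := by
  refine ⟨C * (C ^ dz * C ^ dw * C ^ dx * C), fun o => ?_⟩
  have hC : 0 ≤ C := (abs_nonneg _).trans (hK 0)
  have hprod : ∀ {d : ℕ} (v : Fin d → ℝ), |∏ i, K (v i)| ≤ C ^ d := fun {d} v => by
    rw [Finset.abs_prod]
    calc ∏ i, |K (v i)| ≤ ∏ _i : Fin d, C :=
          Finset.prod_le_prod (fun _ _ => abs_nonneg _) fun i _ => hK _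
      _ = C ^ d := by simp
  simp only [obsKernel, restKernel, abs_mul]
  gcongr
  · exact hK _
  · exact hprod _
  · exact hprod _
  · exact hprod _
  · exact hK _

lemma abs_scaled_le {K : ℝ → ℝ} {C : ℝ} (hK : ∀ u, |K u| ≤ C) {b : ℝ} (hb : 0 < b) (u : ℝ) :
    |scaled K b u| ≤ C / b := by
  rw [scaled, abs_mul, abs_of_pos (by positivity), one_div, inv_mul_eq_div]
  gcongr
  exact hK _

end Kernel

/-! ### Coordinate regroupings that put the conditioning variables first. -/

section Reorder

/-- The equivalence `(a, b, c) ↦ (b, a, c)`. -/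
def prodLeftComm (α β γ : Type*) [MeasurableSpace α] [MeasurableSpace β] [MeasurableSpace γ] :
    α × β × γ ≃ᵐ β × α × γ :=
  MeasurableEquiv.prodAssoc.symm.trans
    ((MeasurableEquiv.prodComm.prodCongr (MeasurableEquiv.refl γ)).trans MeasurableEquiv.prodAssoc)

/-- The equivalence `(z, w, x, y) ↦ ((z, x), (w, y))`. -/
def splitFirstThird (α β γ δ : Type*) [MeasurableSpace α] [MeasurableSpace β] [MeasurableSpace γ]
    [MeasurableSpace δ] : α × β × γ × δ ≃ᵐ (α × γ) × (β × δ) :=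
  ((MeasurableEquiv.refl α).prodCongr (prodLeftComm β γ δ)).trans MeasurableEquiv.prodAssoc.symm

/-- The equivalence `(z, w, x, y) ↦ ((w, x), (z, y))`. -/
def splitSecondThird (α β γ δ : Type*) [MeasurableSpace α] [MeasurableSpace β] [MeasurableSpace γ]
    [MeasurableSpace δ] : α × β × γ × δ ≃ᵐ (β × γ) × (α × δ) :=
  (prodLeftComm α β (γ × δ)).trans (splitFirstThird β α γ δ)

/-- The equivalence `(a, z, w, x, y) ↦ ((w, x), (a, z, y))`. -/
def splitThirdFourth (ε α β γ δ : Type*) [MeasurableSpace ε] [MeasurableSpace α]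
    [MeasurableSpace β] [MeasurableSpace γ] [MeasurableSpace δ] :
    ε × α × β × γ × δ ≃ᵐ (β × γ) × (ε × α × δ) :=
  ((MeasurableEquiv.refl ε).prodCongr (splitSecondThird α β γ δ)).trans
    (prodLeftComm ε (β × γ) (α × δ))

end Reorder

section ReorderVolume

variable {α β γ δ ε : Type*} [MeasureSpace α] [MeasureSpace β] [MeasureSpace γ]
  [MeasureSpace δ] [MeasureSpace ε] [SFinite (volume : Measure α)] [SFinite (volume : Measure β)]
  [SFinite (volume : Measure γ)] [SFinite (volume : Measure δ)] [SFinite (volume : Measure ε)]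

lemma measurePreserving_prodLeftComm : MeasurePreserving (prodLeftComm α β γ) volume volume := by
  have h1 : MeasurePreserving (MeasurableEquiv.prodAssoc : (α × β) × γ ≃ᵐ α × β × γ)
    volume volume := measurePreserving_prodAssoc _ _ _
  have h2 : MeasurePreserving (MeasurableEquiv.prodAssoc : (β × α) × γ ≃ᵐ β × α × γ)
    volume volume := measurePreserving_prodAssoc _ _ _
  have h3 : MeasurePreserving (Prod.map Prod.swap id : (α × β) × γ → (β × α) × γ)
    volume volume := Measure.measurePreserving_swap.prod (MeasurePreserving.id volume)
  exact h2.comp (h3.comp (h1.symm _))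

lemma measurePreserving_splitFirstThird :
    MeasurePreserving (splitFirstThird α β γ δ) volume volume := by
  have h1 : MeasurePreserving (MeasurableEquiv.prodAssoc : (α × γ) × β × δ ≃ᵐ α × γ × β × δ)
    volume volume := measurePreserving_prodAssoc _ _ _
  have h2 : MeasurePreserving (Prod.map id (prodLeftComm β γ δ) : α × β × γ × δ → α × γ × β × δ)
    volume volume := (MeasurePreserving.id volume).prod measurePreserving_prodLeftComm
  exact (h1.symm _).comp h2

lemma measurePreserving_splitSecondThird :
    MeasurePreserving (splitSecondThird α β γ δ) volume volume :=
  measurePreserving_splitFirstThird.comp measurePreserving_prodLeftComm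

lemma measurePreserving_splitThirdFourth :
    MeasurePreserving (splitThirdFourth ε α β γ δ) volume volume := by
  have h2 : MeasurePreserving (Prod.map id (splitSecondThird α β γ δ) :
      ε × α × β × γ × δ → ε × (β × γ) × (α × δ)) volume volume :=
    (MeasurePreserving.id volume).prod measurePreserving_splitSecondThird
  exact measurePreserving_prodLeftComm.comp h2

end ReorderVolume

/-! ### Fubini along a measure-preserving splitting. -/

section Disintegration

variable {Ω S T : Type*} [MeasureSpace Ω] [MeasureSpace S] [MeasureSpace T]

lemma integrable_comp_symm {e : Ω ≃ᵐ S × T} (he : MeasurePreserving e volume volume)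
    {f : Ω → ℝ} : Integrable (fun st => f (e.symm st)) ↔ Integrable f :=
  (he.symm e).integrable_comp_emb e.symm.measurableEmbedding

variable [SFinite (volume : Measure T)]

lemma integrable_of_sections {e : Ω ≃ᵐ S × T} (he : MeasurePreserving e volume volume)
    {f : Ω → ℝ} (hf : Measurable f) (h1 : ∀ᵐ s, Integrable (fun t => f (e.symm (s, t))))
    (h2 : Integrable (fun s => ∫ t, ‖f (e.symm (s, t))‖)) : Integrable f :=
  (integrable_comp_symm he).1 <| (integrable_prod_iff
    (hf.comp e.symm.measurable).aestronglyMeasurable).2 ⟨h1, h2⟩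

lemma integrable_norm_sections {e : Ω ≃ᵐ S × T} (he : MeasurePreserving e volume volume)
    {f : Ω → ℝ} (hf : Integrable f) : Integrable (fun s => ∫ t, ‖f (e.symm (s, t))‖) :=
  ((integrable_comp_symm he).2 hf).integral_norm_prod_left

variable [SFinite (volume : Measure S)]

lemma integral_disintegrate {e : Ω ≃ᵐ S × T} (he : MeasurePreserving e volume volume)
    {f : Ω → ℝ} (hf : Integrable f) : ∫ o, f o = ∫ s, ∫ t, f (e.symm (s, t)) := by
  rw [← (he.symm e).integral_comp' f]
  exact integral_prod _ ((integrable_comp_symm he).2 hf)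

lemma ae_integrable_section {e : Ω ≃ᵐ S × T} (he : MeasurePreserving e volume volume)
    {f : Ω → ℝ} (hf : Integrable f) : ∀ᵐ s, Integrable (fun t => f (e.symm (s, t))) :=
  ((integrable_comp_symm he).2 hf).prod_right_ae

end Disintegration

/-! ### Integration against the slice at the treatment level. -/

section Slice

variable {dz dw dx : ℕ} {p : Obs dz dw dx → ℝ} {a : ℝ}

lemma measurable_slice (hp : Measurable p) (a : ℝ) : Measurable (fun v => p (a, v)) :=
  hp.comp measurable_prodMk_left

lemma integrable_slice_iff (hp : Measurable p) (hnn : ∀ o, 0 ≤ p o) {g : Rest dz dw dx → ℝ} :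
    Integrable g (slice p a) ↔ Integrable (fun v => g v * p (a, v)) := by
  rw [slice, integrable_withDensity_iff (measurable_slice hp a).ennreal_ofReal
    (Eventually.of_forall fun _ => ENNReal.ofReal_lt_top)]
  simp only [ENNReal.toReal_ofReal (hnn _)]

lemma integral_slice (hp : Measurable p) (hnn : ∀ o, 0 ≤ p o) (g : Rest dz dw dx → ℝ) :
    ∫ v, g v ∂(slice p a) = ∫ v, g v * p (a, v) := by
  rw [slice, integral_withDensity_eq_integral_toReal_smul (measurable_slice hp a).ennreal_ofReal
    (Eventually.of_forall fun _ => ENNReal.ofReal_lt_top)]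
  simp only [ENNReal.toReal_ofReal (hnn _), smul_eq_mul, mul_comm]

/-- Cauchy–Schwarz, kept in terms of `eLpNorm` so that the assumed L² convergence of the bridge
functions applies directly. -/
lemma abs_integral_mul_le {Ω : Type*} {_ : MeasurableSpace Ω} {μ : Measure Ω} {f g : Ω → ℝ}
    (hf : MemLp f 2 μ) (hg : MemLp g 2 μ) :
    ∫ v, |f v| * |g v| ∂μ ≤ (eLpNorm f 2 μ * eLpNorm g 2 μ).toReal := by
  have h1 : ∫ v, |f v| * |g v| ∂μ = (eLpNorm (f • g) 1 μ).toReal := by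
    rw [eLpNorm_one_eq_lintegral_enorm, ← integral_norm_eq_lintegral_enorm]
    · simp
    · exact hf.1.mul hg.1
  rw [h1]
  exact ENNReal.toReal_mono (ENNReal.mul_ne_top hf.2.ne hg.2.ne)
    (eLpNorm_smul_le_mul_eLpNorm hg.1 hf.1)

end Slice

/-! ### Consequences of the two bridge equations. -/

section Bridge

variable {dz dw dx : ℕ} {p : Obs dz dw dx → ℝ} {a : ℝ}

/-- The moment equation of an outcome bridge function, tested against a function of `(z, x)`. -/
lemma IsOutcomeBridge.integral_eq_zero {h : (Fin dw → ℝ) → (Fin dx → ℝ) → ℝ}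
    (hh : IsOutcomeBridge p a h) (hnn : ∀ o, 0 ≤ p o)
    (hslice : Integrable (fun v => p (a, v)))
    (q : (Fin dz → ℝ) → (Fin dx → ℝ) → ℝ)
    (hint : Integrable (fun v => weightedResidual h q v * p (a, v))) :
    ∫ v, weightedResidual h q v * p (a, v) = 0 := by
  have he := measurePreserving_splitFirstThird
    (α := Fin dz → ℝ) (β := Fin dw → ℝ) (γ := Fin dx → ℝ) (δ := ℝ)
  rw [integral_disintegrate he hint]
  refine integral_eq_zero_of_ae ?_
  filter_upwards [hh.moment_eq, ae_integrable_section he hslice] with t ht hti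
  change ∫ s : (Fin dw → ℝ) × ℝ, (s.2 - h s.1 t.2) * q t.1 t.2 * p (a, t.1, s.1, t.2, s.2) = 0
  change Integrable (fun s : (Fin dw → ℝ) × ℝ => p (a, t.1, s.1, t.2, s.2)) at hti
  have h0 : ∀ s : (Fin dw → ℝ) × ℝ, 0 ≤ p (a, t.1, s.1, t.2, s.2) := fun s => hnn _
  have hA : 0 ≤ margAZX p a t.1 t.2 := integral_nonneg fun s => hnn _
  rcases hA.lt_or_eq with hpos | hzero
  · have h1 := ht hpos
    simp only [← mul_div_assoc] at h1
    rw [integral_div, div_eq_zero_iff, or_iff_left hpos.ne'] at h1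
    calc _ = ∫ s : (Fin dw → ℝ) × ℝ,
          q t.1 t.2 * ((s.2 - h s.1 t.2) * p (a, t.1, s.1, t.2, s.2)) := by
            congr 1; ext s; ring
      _ = 0 := by rw [integral_const_mul, h1, mul_zero]
  -- Where the marginal vanishes the moment equation is silent, but a nonnegative density with zero
  -- integral vanishes almost everywhere on the fibre.
  · have h1 := (integral_eq_zero_iff_of_nonneg h0 hti).1 hzero.symm
    refine integral_eq_zero_of_ae ?_
    filter_upwards [h1] with s hs
    simp only [Pi.zero_apply] at hs ⊢
    rw [hs, mul_zero]

/-- A treatment bridge function turns integrals over the slice at `a` into integrals over the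
marginal law of `(W, X)`. -/
lemma IsTreatmentBridge.ae_margWX_eq {q : (Fin dz → ℝ) → (Fin dx → ℝ) → ℝ}
    (hq : IsTreatmentBridge p a q) (hnn : ∀ o, 0 ≤ p o)
    (hslice : Integrable (fun v => p (a, v))) (hov : Overlap p a)
    (hqint : Integrable (fun v : Rest dz dw dx => q v.1 v.2.2.1 * p (a, v))) :
    ∀ᵐ t : (Fin dw → ℝ) × (Fin dx → ℝ),
      ∫ s : (Fin dz → ℝ) × ℝ, q s.1 t.2 * p (a, s.1, t.1, t.2, s.2) = margWX p t.1 t.2 := by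
  have he := measurePreserving_splitSecondThird
    (α := Fin dz → ℝ) (β := Fin dw → ℝ) (γ := Fin dx → ℝ) (δ := ℝ)
  filter_upwards [hq.moment_eq, hov, ae_integrable_section he hslice,
    ae_integrable_section he hqint] with t ht hovt hti hqi
  change Integrable (fun s : (Fin dz → ℝ) × ℝ => p (a, s.1, t.1, t.2, s.2)) at hti
  change Integrable (fun s : (Fin dz → ℝ) × ℝ => q s.1 t.2 * p (a, s.1, t.1, t.2, s.2)) at hqi
  have h0 : ∀ s : (Fin dz → ℝ) × ℝ, 0 ≤ p (a, s.1, t.1, t.2, s.2) := fun s => hnn _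
  have hW : 0 ≤ margWX p t.1 t.2 := integral_nonneg fun s => hnn _
  have hA : 0 ≤ margAWX p a t.1 t.2 := integral_nonneg fun s => hnn _
  rcases hA.lt_or_eq with hpos | hzero
  · have h1 := ht hpos
    simp only [← mul_div_assoc] at h1
    rw [integral_div, div_eq_zero_iff, or_iff_left hpos.ne'] at h1
    simp only [sub_mul] at h1
    rw [integral_sub hqi (hti.const_mul _), integral_const_mul, sub_eq_zero] at h1
    -- The factor `1 / policy` is `margWX / margAWX`, and the remaining integral of `p` is `margAWX`
    -- itself.
    rw [h1, policy, one_div, inv_div]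
    exact div_mul_cancel₀ _ hpos.ne'
  · have h1 := (integral_eq_zero_iff_of_nonneg h0 hti).1 hzero.symm
    -- A vanishing `margAWX` makes the policy zero, which overlap allows only where `margWX`
    -- vanishes too.
    have h2 : margWX p t.1 t.2 = 0 := by
      by_contra hne
      have h3 := hovt (lt_of_le_of_ne hW (Ne.symm hne))
      rw [policy, ← hzero, zero_div] at h3
      exact lt_irrefl _ h3
    rw [h2]
    refine integral_eq_zero_of_ae ?_
    filter_upwards [h1] with s hs
    simp only [Pi.zero_apply] at hs ⊢
    rw [hs, mul_zero]

variable {q : (Fin dz → ℝ) → (Fin dx → ℝ) → ℝ} {k : (Fin dw → ℝ) → (Fin dx → ℝ) → ℝ}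

/-- Bridge functions are controlled only on the slice. Integrability under the full law follows from
`margWX = ∫ q p(a,·)`: it gives |k| `margWX` ≤ ∫ |k q| p(a,·), whatever the sign of `q`. -/
lemma IsTreatmentBridge.integrable_mul (hq : IsTreatmentBridge p a q) (hp : IsDensity p)
    (hslice : Integrable (fun v => p (a, v))) (hov : Overlap p a)
    (hqint : Integrable (fun v : Rest dz dw dx => q v.1 v.2.2.1 * p (a, v)))
    (hk : Measurable (fun s : (Fin dw → ℝ) × (Fin dx → ℝ) => k s.1 s.2))
    (hkq : Integrable
      (fun v : Rest dz dw dx => k v.2.1 v.2.2.1 * (q v.1 v.2.2.1 * p (a, v)))) :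
    Integrable (fun o : Obs dz dw dx => k o.2.2.1 o.2.2.2.1 * p o) := by
  have he := measurePreserving_splitSecondThird
    (α := Fin dz → ℝ) (β := Fin dw → ℝ) (γ := Fin dx → ℝ) (δ := ℝ)
  have hE := measurePreserving_splitThirdFourth
    (ε := ℝ) (α := Fin dz → ℝ) (β := Fin dw → ℝ) (γ := Fin dx → ℝ) (δ := ℝ)
  have hmeas : Measurable (fun o : Obs dz dw dx => k o.2.2.1 o.2.2.2.1 * p o) :=
    (hk.comp (by fun_prop : Measurable
      (fun o : Obs dz dw dx => (o.2.2.1, o.2.2.2.1)))).mul hp.measurable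
  refine integrable_of_sections hE hmeas ?_ ?_
  · filter_upwards [ae_integrable_section hE hp.integrable] with t ht
    exact ht.const_mul (k t.1 t.2)
  · refine (integrable_norm_sections he hkq).mono' ?_ ?_
    · exact (((hmeas.norm.comp (splitThirdFourth ℝ (Fin dz → ℝ) (Fin dw → ℝ) (Fin dx → ℝ)
        ℝ).symm.measurable).stronglyMeasurable).integral_prod_right').aestronglyMeasurable
    · filter_upwards [hq.ae_margWX_eq hp.nonneg hslice hov hqint] with t ht
      change ‖∫ s : ℝ × (Fin dz → ℝ) × ℝ, ‖k t.1 t.2 * p (s.1, s.2.1, t.1, t.2, s.2.2)‖‖ ≤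
        ∫ s : (Fin dz → ℝ) × ℝ, ‖k t.1 t.2 * (q s.1 t.2 * p (a, s.1, t.1, t.2, s.2))‖
      have h1 : ∀ s : ℝ × (Fin dz → ℝ) × ℝ, ‖p (s.1, s.2.1, t.1, t.2, s.2.2)‖ =
        p (s.1, s.2.1, t.1, t.2, s.2.2) := fun s => Real.norm_of_nonneg (hp.nonneg _)
      simp only [norm_mul, h1]
      rw [integral_const_mul, norm_mul, norm_norm]
      have h2 := norm_integral_le_integral_norm (μ := volume)
        (fun s : (Fin dz → ℝ) × ℝ => q s.1 t.2 * p (a, s.1, t.1, t.2, s.2))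
      rw [ht] at h2
      simp only [norm_mul] at h2
      rw [integral_const_mul]
      exact mul_le_mul_of_nonneg_left h2 (norm_nonneg _)

/-- Inverse probability weighting by a treatment bridge function. -/
lemma IsTreatmentBridge.integral_mul_eq (hq : IsTreatmentBridge p a q) (hp : IsDensity p)
    (hslice : Integrable (fun v => p (a, v))) (hov : Overlap p a)
    (hqint : Integrable (fun v : Rest dz dw dx => q v.1 v.2.2.1 * p (a, v)))
    (hk : Measurable (fun s : (Fin dw → ℝ) × (Fin dx → ℝ) => k s.1 s.2))
    (hkq : Integrable
      (fun v : Rest dz dw dx => k v.2.1 v.2.2.1 * (q v.1 v.2.2.1 * p (a, v)))) :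
    ∫ o : Obs dz dw dx, k o.2.2.1 o.2.2.2.1 * p o =
      ∫ v : Rest dz dw dx, k v.2.1 v.2.2.1 * (q v.1 v.2.2.1 * p (a, v)) := by
  have he := measurePreserving_splitSecondThird
    (α := Fin dz → ℝ) (β := Fin dw → ℝ) (γ := Fin dx → ℝ) (δ := ℝ)
  have hE := measurePreserving_splitThirdFourth
    (ε := ℝ) (α := Fin dz → ℝ) (β := Fin dw → ℝ) (γ := Fin dx → ℝ) (δ := ℝ)
  rw [integral_disintegrate hE (hq.integrable_mul hp hslice hov hqint hk hkq),
    integral_disintegrate he hkq]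
  refine integral_congr_ae ?_
  filter_upwards [hq.ae_margWX_eq hp.nonneg hslice hov hqint] with t ht
  change ∫ s : ℝ × (Fin dz → ℝ) × ℝ, k t.1 t.2 * p (s.1, s.2.1, t.1, t.2, s.2.2) =
    ∫ s : (Fin dz → ℝ) × ℝ, k t.1 t.2 * (q s.1 t.2 * p (a, s.1, t.1, t.2, s.2))
  rw [integral_const_mul, integral_const_mul, ht]
  rfl

end Bridge

/-! ### Signed perturbations dominated by a multiple of the density. -/

section Domination

variable {Ω : Type*} [MeasurableSpace Ω] {μ : Measure Ω} {g r p : Ω → ℝ} {M : ℝ}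

lemma integrable_mul_of_abs_le (hg : Measurable g) (hr : Measurable r)
    (hrp : ∀ o, |r o| ≤ M * p o) (h : Integrable (fun o => g o * p o) μ) :
    Integrable (fun o => g o * r o) μ := by
  refine (h.norm.const_mul |M|).mono' (hg.mul hr).aestronglyMeasurable
    (Eventually.of_forall fun o => ?_)
  simp only [Real.norm_eq_abs, abs_mul]
  calc |g o| * |r o| ≤ |g o| * |M * p o| := by
        exact mul_le_mul_of_nonneg_left ((hrp o).trans (le_abs_self _)) (abs_nonneg _)
    _ = _ := by rw [abs_mul]; ring

lemma abs_integral_mul_le_of_abs_le (hp : ∀ o, 0 ≤ p o)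
    (hrp : ∀ o, |r o| ≤ M * p o) (h : Integrable (fun o => g o * p o) μ) :
    |∫ o, g o * r o ∂μ| ≤ M * ∫ o, |g o| * p o ∂μ := by
  rw [← integral_const_mul, ← Real.norm_eq_abs]
  have h1 : Integrable (fun o => |g o| * p o) μ := by
    refine h.norm.congr (Eventually.of_forall fun o => ?_)
    simp [abs_of_nonneg (hp o)]
  refine norm_integral_le_of_norm_le (h1.const_mul M) (Eventually.of_forall fun o => ?_)
  rw [Real.norm_eq_abs, abs_mul]
  calc |g o| * |r o| ≤ |g o| * (M * p o) := by gcongr; exact hrp o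
    _ = _ := by ring

lemma integral_mixture (ε : ℝ) (hp : Integrable (fun o => g o * p o) μ)
    (hr : Integrable (fun o => g o * r o) μ) :
    ∫ o, g o * ((1 - ε) * p o + ε * r o) ∂μ =
      (1 - ε) * ∫ o, g o * p o ∂μ + ε * ∫ o, g o * r o ∂μ := by
  rw [← integral_const_mul, ← integral_const_mul,
    ← integral_add (hp.const_mul _) (hr.const_mul _)]
  congr 1; ext o; ring

end Domination

/-! ### The difference quotient along a mixture. -/

section Mixture

variable {dz dw dx : ℕ} {p r : Obs dz dw dx → ℝ} {a M : ℝ}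
  {h k : (Fin dw → ℝ) → (Fin dx → ℝ) → ℝ} {q : (Fin dz → ℝ) → (Fin dx → ℝ) → ℝ}

lemma measurable_weightedResidual
    (hh : Measurable (fun s : (Fin dw → ℝ) × (Fin dx → ℝ) => h s.1 s.2))
    (hq : Measurable (fun s : (Fin dz → ℝ) × (Fin dx → ℝ) => q s.1 s.2)) :
    Measurable (weightedResidual h q) := by
  have h1 : Measurable (fun v : Rest dz dw dx => h v.2.1 v.2.2.1) :=
    hh.comp (by fun_prop : Measurable (fun v : Rest dz dw dx => (v.2.1, v.2.2.1)))
  have h2 : Measurable (fun v : Rest dz dw dx => q v.1 v.2.2.1) :=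
    hq.comp (by fun_prop : Measurable (fun v : Rest dz dw dx => (v.1, v.2.2.1)))
  exact (Measurable.sub (by fun_prop) h1).mul h2

lemma integrable_mul_mul_slice (hp : Measurable p) (hnn : ∀ o, 0 ≤ p o)
    {f g : Rest dz dw dx → ℝ} (hf : MemLp f 2 (slice p a)) (hg : MemLp g 2 (slice p a)) :
    Integrable (fun v => f v * g v * p (a, v)) :=
  (integrable_slice_iff hp hnn).1 (hf.integrable_mul hg)

/-- The difference quotient of the mean of the bridge functions along a mixture
`(1 - ε) p + ε r` differs from the integral of the influence function against `r` by a
multiple of the distance of the bridge functions. -/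
lemma abs_quotient_sub_le (hp : IsDensity p) (hr : Measurable r) (hM : 0 ≤ M)
    (hrp : ∀ o, |r o| ≤ M * p o) (hslice : Integrable (fun v => p (a, v)))
    (hY : MemLp (fun v : Rest dz dw dx => v.2.2.2) 2 (slice p a)) (hov : Overlap p a)
    (hh : IsOutcomeBridge p a h) (hq : IsTreatmentBridge p a q) {ε : ℝ} (hε : 0 < ε)
    (hnn : ∀ o, 0 ≤ (1 - ε) * p o + ε * r o)
    (hk : IsOutcomeBridge (fun o => (1 - ε) * p o + ε * r o) a k)
    (hkh : eLpNorm (fun v : Rest dz dw dx => k v.2.1 v.2.2.1 - h v.2.1 v.2.2.1) 2 (slice p a)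
      < ⊤) :
    |((∫ o : Obs dz dw dx, k o.2.2.1 o.2.2.2.1 * ((1 - ε) * p o + ε * r o)) -
        ∫ o : Obs dz dw dx, h o.2.2.1 o.2.2.2.1 * p o) / ε -
      ((∫ v, weightedResidual h q v * r (a, v)) +
        (∫ o : Obs dz dw dx, h o.2.2.1 o.2.2.2.1 * r o) -
        ∫ o : Obs dz dw dx, h o.2.2.1 o.2.2.2.1 * p o)| ≤
      2 * M * (eLpNorm (fun v : Rest dz dw dx => k v.2.1 v.2.2.1 - h v.2.1 v.2.2.1) 2
        (slice p a) * eLpNorm (fun v : Rest dz dw dx => q v.1 v.2.2.1) 2 (slice p a)).toReal := by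
  have hfin : IsFiniteMeasure (slice p a) := isFiniteMeasure_withDensity_ofReal hslice.2
  set d : (Fin dw → ℝ) → (Fin dx → ℝ) → ℝ := fun w x => k w x - h w x with hd
  have hdm : Measurable (fun s : (Fin dw → ℝ) × (Fin dx → ℝ) => d s.1 s.2) :=
    hk.measurable.sub hh.measurable
  have hproj : Measurable (fun v : Rest dz dw dx => (v.2.1, v.2.2.1)) := by fun_prop
  have hprojO : Measurable (fun o : Obs dz dw dx => (o.2.2.1, o.2.2.2.1)) := by fun_prop
  have hprojq : Measurable (fun v : Rest dz dw dx => (v.1, v.2.2.1)) := by fun_prop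
  have hdL : MemLp (fun v : Rest dz dw dx => d v.2.1 v.2.2.1) 2 (slice p a) :=
    ⟨(hdm.comp hproj).aestronglyMeasurable, hkh⟩
  -- The bridge property of `k` gives square integrability only on the slice of the mixture. On the
  -- slice of `p` it comes from `k = d + h`.
  have hkL : MemLp (fun v : Rest dz dw dx => k v.2.1 v.2.2.1) 2 (slice p a) :=
    (hdL.add hh.memLp).ae_eq (Eventually.of_forall fun v => by simp [hd])
  have hpm := hp.measurable
  have hpnn := hp.nonneg
  have hra : Measurable (fun v => r (a, v)) := measurable_slice hr a
  have hrpa : ∀ v, |r (a, v)| ≤ M * p (a, v) := fun v => hrp _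
  have hqint : Integrable (fun v : Rest dz dw dx => q v.1 v.2.2.1 * p (a, v)) :=
    (integrable_slice_iff hpm hpnn).1 (hq.memLp.integrable one_le_two)
  have hgq : ∀ {g : (Fin dw → ℝ) → (Fin dx → ℝ) → ℝ},
      MemLp (fun v : Rest dz dw dx => g v.2.1 v.2.2.1) 2 (slice p a) →
      Integrable (fun v : Rest dz dw dx => g v.2.1 v.2.2.1 * (q v.1 v.2.2.1 * p (a, v))) := by
    intro g hg
    simpa only [mul_assoc] using integrable_mul_mul_slice hpm hpnn hg hq.memLp
  have hgp : ∀ {g : (Fin dw → ℝ) → (Fin dx → ℝ) → ℝ},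
      Measurable (fun s : (Fin dw → ℝ) × (Fin dx → ℝ) => g s.1 s.2) →
      MemLp (fun v : Rest dz dw dx => g v.2.1 v.2.2.1) 2 (slice p a) →
      Integrable (fun o : Obs dz dw dx => g o.2.2.1 o.2.2.2.1 * p o) := fun hgm hg =>
    hq.integrable_mul hp hslice hov hqint hgm (hgq hg)
  -- residuals weighted by the treatment bridge
  have hRk : Integrable (fun v => weightedResidual k q v * p (a, v)) :=
    integrable_mul_mul_slice hpm hpnn (hY.sub hkL) hq.memLp
  have hRh : Integrable (fun v => weightedResidual h q v * p (a, v)) :=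
    integrable_mul_mul_slice hpm hpnn (hY.sub hh.memLp) hq.memLp
  have hRkr := integrable_mul_of_abs_le
    (measurable_weightedResidual hk.measurable hq.measurable) hra hrpa hRk
  have hRhr := integrable_mul_of_abs_le
    (measurable_weightedResidual hh.measurable hq.measurable) hra hrpa hRh
  have hra_int : Integrable (fun v => r (a, v)) := by
    have h1 := integrable_mul_of_abs_le (g := fun _ => (1 : ℝ)) measurable_const hra hrpa
      (by simpa using hslice)
    simpa using h1
  have e1 : (1 - ε) * (∫ v, weightedResidual k q v * p (a, v)) +
      ε * ∫ v, weightedResidual k q v * r (a, v) = 0 := by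
    rw [← integral_mixture ε hRk hRkr]
    refine hk.integral_eq_zero hnn ((hslice.const_mul _).add (hra_int.const_mul _)) q ?_
    refine ((hRk.const_mul (1 - ε)).add (hRkr.const_mul ε)).congr
      (Eventually.of_forall fun v => ?_)
    simp only [Pi.add_apply]; ring
  have e2 : ∫ v, weightedResidual h q v * p (a, v) = 0 :=
    hh.integral_eq_zero hpnn hslice q hRh
  have hdr := integrable_mul_of_abs_le 
    (g := fun v : Rest dz dw dx => d v.2.1 v.2.2.1 * q v.1 v.2.2.1)
    ((hdm.comp hproj).mul (hq.measurable.comp hprojq)) hra hrpa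
    (integrable_mul_mul_slice hpm hpnn hdL hq.memLp)
  have e3 : ∫ v, weightedResidual k q v * p (a, v) =
      -∫ v : Rest dz dw dx, d v.2.1 v.2.2.1 * (q v.1 v.2.2.1 * p (a, v)) := by
    rw [← zero_sub, ← e2, ← integral_sub hRh (hgq hdL)]
    congr 1; ext v; simp only [weightedResidual, hd]; ring
  have e4 : ∫ v, weightedResidual k q v * r (a, v) = (∫ v, weightedResidual h q v * r (a, v)) -
      ∫ v : Rest dz dw dx, d v.2.1 v.2.2.1 * q v.1 v.2.2.1 * r (a, v) := by
    rw [← integral_sub hRhr hdr]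
    congr 1; ext v; simp only [weightedResidual, hd]; ring
  have hkp := hgp hk.measurable hkL
  have hhp := hgp hh.measurable hh.memLp
  have hdp := hgp hdm hdL
  have hkr := integrable_mul_of_abs_le (g := fun o : Obs dz dw dx => k o.2.2.1 o.2.2.2.1)
    (hk.measurable.comp hprojO) hr hrp hkp
  have hhr := integrable_mul_of_abs_le (g := fun o : Obs dz dw dx => h o.2.2.1 o.2.2.2.1)
    (hh.measurable.comp hprojO) hr hrp hhp
  have hdr' := integrable_mul_of_abs_le (g := fun o : Obs dz dw dx => d o.2.2.1 o.2.2.2.1)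
    (hdm.comp hprojO) hr hrp hdp
  have e5 : ∫ o : Obs dz dw dx, d o.2.2.1 o.2.2.2.1 * p o =
      ∫ v : Rest dz dw dx, d v.2.1 v.2.2.1 * (q v.1 v.2.2.1 * p (a, v)) :=
    hq.integral_mul_eq hp hslice hov hqint hdm (hgq hdL)
  have e6 : ∫ o : Obs dz dw dx, k o.2.2.1 o.2.2.2.1 * p o =
      (∫ o : Obs dz dw dx, h o.2.2.1 o.2.2.2.1 * p o) +
        ∫ o : Obs dz dw dx, d o.2.2.1 o.2.2.2.1 * p o := by
    rw [← integral_add hhp hdp]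
    congr 1; ext o; simp only [hd]; ring
  have e7 : ∫ o : Obs dz dw dx, k o.2.2.1 o.2.2.2.1 * r o =
      (∫ o : Obs dz dw dx, h o.2.2.1 o.2.2.2.1 * r o) +
        ∫ o : Obs dz dw dx, d o.2.2.1 o.2.2.2.1 * r o := by
    rw [← integral_add hhr hdr']
    congr 1; ext o; simp only [hd]; ring
  have e8 := integral_mixture (g := fun o : Obs dz dw dx => k o.2.2.1 o.2.2.2.1) ε hkp hkr
  -- bounds on the remainder terms
  set N := (eLpNorm (fun v : Rest dz dw dx => d v.2.1 v.2.2.1) 2 (slice p a) *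
    eLpNorm (fun v : Rest dz dw dx => q v.1 v.2.2.1) 2 (slice p a)).toReal with hN
  have b0 : ∫ v : Rest dz dw dx, |d v.2.1 v.2.2.1| * |q v.1 v.2.2.1| * p (a, v) ≤ N := by
    rw [← integral_slice hpm hpnn]
    exact abs_integral_mul_le hdL hq.memLp
  have b1 : |∫ v : Rest dz dw dx, d v.2.1 v.2.2.1 * q v.1 v.2.2.1 * r (a, v)| ≤ M * N := by
    refine (abs_integral_mul_le_of_abs_le (fun v => hpnn _) hrpa
      (integrable_mul_mul_slice hpm hpnn hdL hq.memLp)).trans ?_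
    simp only [abs_mul]
    exact mul_le_mul_of_nonneg_left b0 hM
  -- This integral runs over all treatment levels. The treatment bridge, applied to `|d|`, brings it
  -- back to the slice and to the same bound `N`.
  have b2 : |∫ o : Obs dz dw dx, d o.2.2.1 o.2.2.2.1 * r o| ≤ M * N := by
    refine (abs_integral_mul_le_of_abs_le hpnn hrp hdp).trans
      (mul_le_mul_of_nonneg_left ?_ hM)
    have hdL' : MemLp (fun v : Rest dz dw dx => |d v.2.1 v.2.2.1|) 2 (slice p a) := hdL.norm
    have hdq := hgq (g := fun w x => |d w x|) hdL'
    have h1 := hq.integral_mul_eq (k := fun w x => |d w x|) hp hslice hov hqint hdm.norm hdq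
    refine h1.le.trans (le_trans ?_ b0)
    refine integral_mono hdq
      (integrable_mul_mul_slice hpm hpnn hdL' hq.memLp.norm) fun v => ?_
    have h2 := mul_le_mul_of_nonneg_right (le_abs_self (q v.1 v.2.2.1)) (hpnn (a, v))
    have h3 := mul_le_mul_of_nonneg_left h2 (abs_nonneg (d v.2.1 v.2.2.1))
    simpa only [Real.norm_eq_abs, mul_assoc] using h3
  -- The moment equation now reads `(1 - ε) ∫ d p = ε ∫ (y - k) q r(a,·)`. Substituting it into the
  -- expansion of the mixture mean makes the division by `ε` exact.
  have e9 : ((∫ o : Obs dz dw dx, k o.2.2.1 o.2.2.2.1 * ((1 - ε) * p o + ε * r o)) -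
        ∫ o : Obs dz dw dx, h o.2.2.1 o.2.2.2.1 * p o) / ε -
      ((∫ v, weightedResidual h q v * r (a, v)) +
        (∫ o : Obs dz dw dx, h o.2.2.1 o.2.2.2.1 * r o) -
        ∫ o : Obs dz dw dx, h o.2.2.1 o.2.2.2.1 * p o) =
      (∫ o : Obs dz dw dx, d o.2.2.1 o.2.2.2.1 * r o) -
        ∫ v : Rest dz dw dx, d v.2.1 v.2.2.1 * q v.1 v.2.2.1 * r (a, v) := by
    rw [e3, ← e5, e4] at e1
    rw [sub_eq_iff_eq_add, div_eq_iff hε.ne']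
    rw [e6, e7] at e8
    linear_combination e8 - e1
  rw [e9]
  refine (abs_sub _ _).trans ?_
  linarith

/-- Gateaux derivative of the mean of the outcome bridge functions along a mixture. -/
lemma hasDerivWithinAt_integral_bridge (hp : IsDensity p) (hr : Measurable r) (hM : 0 ≤ M)
    (hrp : ∀ o, |r o| ≤ M * p o) (hslice : Integrable (fun v => p (a, v)))
    (hY : MemLp (fun v : Rest dz dw dx => v.2.2.2) 2 (slice p a)) (hov : Overlap p a)
    (hh : IsOutcomeBridge p a h) (hq : IsTreatmentBridge p a q)
    {k : ℝ → (Fin dw → ℝ) → (Fin dx → ℝ) → ℝ} (hk0 : k 0 = h)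
    (hk : ∀ᶠ ε in 𝓝[>] (0 : ℝ), IsOutcomeBridge (fun o => (1 - ε) * p o + ε * r o) a (k ε))
    (hlim : Tendsto (fun ε => eLpNorm (fun v : Rest dz dw dx =>
      k ε v.2.1 v.2.2.1 - h v.2.1 v.2.2.1) 2 (slice p a)) (𝓝[>] 0) (𝓝 0)) :
    HasDerivWithinAt (fun ε => ∫ o : Obs dz dw dx,
        k ε o.2.2.1 o.2.2.2.1 * ((1 - ε) * p o + ε * r o))
      ((∫ v, weightedResidual h q v * r (a, v)) +
        (∫ o : Obs dz dw dx, h o.2.2.1 o.2.2.2.1 * r o) -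
        ∫ o : Obs dz dw dx, h o.2.2.1 o.2.2.2.1 * p o) (Ici 0) 0 := by
  rw [hasDerivWithinAt_iff_tendsto_slope, Ici_sdiff_left, tendsto_iff_norm_sub_tendsto_zero]
  have hN : Tendsto (fun ε => 2 * M * (eLpNorm (fun v : Rest dz dw dx =>
      k ε v.2.1 v.2.2.1 - h v.2.1 v.2.2.1) 2 (slice p a) *
      eLpNorm (fun v : Rest dz dw dx => q v.1 v.2.2.1) 2 (slice p a)).toReal)
      (𝓝[>] 0) (𝓝 0) := by
    have h1 := ENNReal.Tendsto.mul_const hlim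
      (Or.inr hq.memLp.2.ne : (0 : ENNReal) ≠ 0 ∨ _)
    rw [zero_mul] at h1
    simpa using ((ENNReal.tendsto_toReal ENNReal.zero_ne_top).comp h1).const_mul (2 * M)
  -- The kernel may be negative. This bound on `ε` gives `(1 - ε) p + ε r ≥ (1 - ε - ε M) p ≥ 0`,
  -- and the tested moment equation requires a nonnegative density.
  have hsmall : ∀ᶠ ε in 𝓝[>] (0 : ℝ), ε < 1 / (1 + M) :=
    nhdsWithin_le_nhds (eventually_lt_nhds (by positivity))
  refine tendsto_of_tendsto_of_tendsto_of_le_of_le' tendsto_const_nhds hN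
    (Eventually.of_forall fun ε => norm_nonneg _) ?_
  filter_upwards [hk, hlim.eventually_lt_const ENNReal.zero_lt_top, hsmall,
    self_mem_nhdsWithin] with ε hkε hfin hε hpos
  have hpos : 0 < ε := hpos
  have hnn : ∀ o, 0 ≤ (1 - ε) * p o + ε * r o := fun o => by
    rw [lt_div_iff₀ (by positivity)] at hε
    have h1 := (abs_le.1 (hrp o)).1
    have h2 := hp.nonneg o
    nlinarith [mul_le_mul_of_nonneg_left h1 hpos.le, mul_le_mul_of_nonneg_right hε.le h2]
  have := abs_quotient_sub_le hp hr hM hrp hslice hY hov hh hq hpos hnn hkε hfin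
  simpa [slope_def_field, hk0] using this

end Mixture

/-! ### Lebesgue measure on the nested products is Haar, as the substitution `v = V - b u` requires.
-/

section Haar

lemma isAddHaarMeasure_volume_prod {E F : Type*} [AddGroup E] [AddGroup F]
    [TopologicalSpace E] [TopologicalSpace F] [MeasureSpace E] [MeasureSpace F]
    [(volume : Measure E).IsAddHaarMeasure] [(volume : Measure F).IsAddHaarMeasure]
    [SFinite (volume : Measure E)] [SFinite (volume : Measure F)]
    [MeasurableAdd E] [MeasurableAdd F] :
    (volume : Measure (E × F)).IsAddHaarMeasure :=
  inferInstanceAs (((volume : Measure E).prod (volume : Measure F)).IsAddHaarMeasure)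

instance isAddHaarMeasure_volume_rest {dz dw dx : ℕ} :
    (volume : Measure (Rest dz dw dx)).IsAddHaarMeasure := by
  have h1 : (volume : Measure ((Fin dx → ℝ) × ℝ)).IsAddHaarMeasure := isAddHaarMeasure_volume_prod
  have h2 : (volume : Measure ((Fin dw → ℝ) × (Fin dx → ℝ) × ℝ)).IsAddHaarMeasure :=
    isAddHaarMeasure_volume_prod
  exact isAddHaarMeasure_volume_prod

instance isAddHaarMeasure_volume_obs {dz dw dx : ℕ} :
    (volume : Measure (Obs dz dw dx)).IsAddHaarMeasure :=
  isAddHaarMeasure_volume_prod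

end Haar

/-! ### The truncated kernel perturbation. -/

section Perturbation

variable {dz dw dx : ℕ} {p : Obs dz dw dx → ℝ} {K : ℝ → ℝ}

lemma measurable_scaled (hK : Measurable K) (b : ℝ) : Measurable (scaled K b) :=
  (hK.comp (measurable_id.div_const b)).const_mul _

lemma measurable_pertDensity (hp : Measurable p) (hK : Measurable K) (O : Obs dz dw dx) (b : ℝ) :
    Measurable (pertDensity p K O b) :=
  ((measurable_obsKernel (measurable_scaled hK b)).comp (by fun_prop)).indicator
    (measurableSet_lt measurable_const hp)

/-- This is what the truncation is for: where the perturbation is nonzero, `p > b`, so a bound `C'`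
on the rescaled kernel becomes `(C' / b) p`. The constant depends on `b`, which is harmless because
`ε` tends to 0 with `b` fixed. -/
lemma exists_abs_pertDensity_le (hnn : ∀ o, 0 ≤ p o) {C : ℝ} (hC : ∀ u, |K u| ≤ C)
    (O : Obs dz dw dx) {b : ℝ} (hb : 0 < b) :
    ∃ M, 0 ≤ M ∧ ∀ o, |pertDensity p K O b o| ≤ M * p o := by
  obtain ⟨C', hC'⟩ := exists_abs_obsKernel_le (dz := dz) (dw := dw) (dx := dx)
    (fun u => abs_scaled_le hC hb u)
  have h0 : 0 ≤ C' := (abs_nonneg _).trans (hC' O)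
  refine ⟨C' / b, by positivity, fun o => ?_⟩
  by_cases ho : b < p o
  · rw [pertDensity, indicator_of_mem (by exact ho)]
    calc |obsKernel (scaled K b) (O - o)| ≤ C' := hC' _
      _ = C' / b * b := (div_mul_cancel₀ _ hb.ne').symm
      _ ≤ _ := by gcongr
  · rw [pertDensity, indicator_of_notMem (by exact ho), abs_zero]
    have := hnn o
    positivity

lemma integral_mul_pertDensity (g : Obs dz dw dx → ℝ) (O : Obs dz dw dx) {b : ℝ} (hb : 0 < b) :
    ∫ o, g o * pertDensity p K O b o =
      ∫ u, indicator {o | b < p o} g (O - b • u) * obsKernel K u := by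
  rw [← integral_mul_comp_smul_sub _ _ _ hb]
  congr 1; ext o
  rw [← obsKernel_scaled]
  by_cases ho : b < p o <;> simp [pertDensity, indicator, ho]

/-- On the slice the treatment coordinate is fixed at `a`, so its kernel factor leaves the integral
unsmoothed; this is the source of the possibly divergent `K_b(A - a)`. -/
lemma integral_mul_pertDensity_slice (g : Rest dz dw dx → ℝ) (A a : ℝ) (V : Rest dz dw dx)
    {b : ℝ} (hb : 0 < b) :
    ∫ v, g v * pertDensity p K (A, V) b (a, v) =
      (∫ u, indicator {v | b < p (a, v)} g (V - b • u) * restKernel K u) *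
        scaled K b (A - a) := by
  rw [← integral_mul_comp_smul_sub _ _ _ hb, ← integral_mul_const]
  congr 1; ext v
  rw [← restKernel_scaled]
  by_cases hv : b < p (a, v)
  · simp [pertDensity, indicator, hv, obsKernel]; ring
  · simp [pertDensity, indicator, hv]

end Perturbation

end Proximal

/-! ### The Gateaux derivative and its small-bandwidth limit. -/

theorem theorem2 {dz dw dx : ℕ}
    -- the true density, the kernel, the treatment level, the observation (A, Z, W, X, Y)
    (p : Proximal.Obs dz dw dx → ℝ) (hp : Proximal.IsDensity p)
    (K : ℝ → ℝ) (hK : Proximal.IsKernel K)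
    (a A : ℝ) (Z : Fin dz → ℝ) (W : Fin dw → ℝ) (X : Fin dx → ℝ) (Y : ℝ)
    -- the bridge functions
    (h₀ : (Proximal.Obs dz dw dx → ℝ) → ℝ → (Fin dw → ℝ) → (Fin dx → ℝ) → ℝ)
    (q₀ : ℝ → (Fin dz → ℝ) → (Fin dx → ℝ) → ℝ)
    (hh₀ : Proximal.IsOutcomeBridge p a (h₀ p a))
    (hq₀ : Proximal.IsTreatmentBridge p a (q₀ a))
    (hoverlap : Proximal.Overlap p a)
    (hslice : Integrable (fun v : Proximal.Rest dz dw dx => p (a, v)))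
    (hY : MemLp (fun v : Proximal.Rest dz dw dx => v.2.2.2) 2 (Proximal.slice p a))
    -- the submodel stays in the model, with a bridge function that is continuous at ε = 0
    (hsub : ∀ᶠ b in 𝓝[>] (0 : ℝ), ∀ᶠ ε in 𝓝[>] (0 : ℝ),
      Proximal.IsOutcomeBridge (Proximal.submodel p K (A, Z, W, X, Y) b ε) a
        (h₀ (Proximal.submodel p K (A, Z, W, X, Y) b ε) a))
    (hcont : ∀ᶠ b in 𝓝[>] (0 : ℝ), Tendsto
      (fun ε : ℝ => eLpNorm (fun v : Proximal.Rest dz dw dx =>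
        h₀ (Proximal.submodel p K (A, Z, W, X, Y) b ε) a v.2.1 v.2.2.1 - h₀ p a v.2.1 v.2.2.1)
        2 (Proximal.slice p a))
      (𝓝[>] 0) (𝓝 0))
    -- local regularity at the observation
    (hpO : 0 < p (A, Z, W, X, Y)) (hpO' : ContinuousAt p (A, Z, W, X, Y))
    (hpa : 0 < p (a, Z, W, X, Y)) (hpa' : ContinuousAt p (a, Z, W, X, Y))
    (hcont_h : ContinuousAt (fun s : (Fin dw → ℝ) × (Fin dx → ℝ) => h₀ p a s.1 s.2) (W, X))
    (hcont_q : ContinuousAt (fun s : (Fin dz → ℝ) × (Fin dx → ℝ) => q₀ a s.1 s.2) (Z, X))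
    (hdom_h : Proximal.KernelDominated K 0 (Z, W, X, Y) (fun v => h₀ p a v.2.1 v.2.2.1))
    (hdom_r : Proximal.KernelDominated K 0 (Z, W, X, Y)
      (Proximal.weightedResidual (h₀ p a) (q₀ a))) :
    ∃ D : ℝ → ℝ,
      -- the Gateaux derivative at ε = 0 along the submodel with bandwidth b exists and is D b
      (∀ᶠ b in 𝓝[>] (0 : ℝ), HasDerivWithinAt
        (fun ε : ℝ => Proximal.beta h₀ a (Proximal.submodel p K (A, Z, W, X, Y) b ε))
        (D b) (Ici 0) 0) ∧
      -- its limit, whenever K_b(A - a) has a limit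
      (∀ L : ℝ, Tendsto (fun b => Proximal.scaled K b (A - a)) (𝓝[>] 0) (𝓝 L) →
        Tendsto D (𝓝[>] 0)
          (𝓝 ((Y - h₀ p a W X) * q₀ a Z X * L + h₀ p a W X - Proximal.beta h₀ a p))) ∧
      -- comparison with the kernel form, also where K_b(A - a) diverges
      ((fun b => D b -
          (Proximal.kernelDR K (h₀ p a) (q₀ a) a b (A, Z, W, X, Y) - Proximal.beta h₀ a p))
        =o[𝓝[>] 0] (fun b => 1 + |Proximal.scaled K b (A - a)|)) ∧
      -- under differentiability at the observation, the difference vanishes in the limit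
      (DifferentiableAt ℝ (Proximal.weightedResidual (h₀ p a) (q₀ a)) (Z, W, X, Y) →
        Proximal.KernelDominated K 1 (Z, W, X, Y)
          (Proximal.weightedResidual (h₀ p a) (q₀ a)) →
        Tendsto (fun b => D b -
          (Proximal.kernelDR K (h₀ p a) (q₀ a) a b (A, Z, W, X, Y) - Proximal.beta h₀ a p))
          (𝓝[>] 0) (𝓝 0)) := by
  obtain ⟨C, hC⟩ := hK.bounded
  set f : Proximal.Rest dz dw dx → ℝ := Proximal.weightedResidual (h₀ p a) (q₀ a) with hf
  set V : Proximal.Rest dz dw dx := (Z, W, X, Y) with hV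
  set s : ℝ → ℝ := fun b => Proximal.scaled K b (A - a) with hs
  set J : ℝ → ℝ := fun b =>
    ∫ u, indicator {v | b < p (a, v)} f (V - b • u) * Proximal.restKernel K u with hJ
  set I : ℝ → ℝ := fun b => ∫ u : Proximal.Obs dz dw dx, indicator {o | b < p o}
    (fun o : Proximal.Obs dz dw dx => h₀ p a o.2.2.1 o.2.2.2.1) ((A, V) - b • u) *
      Proximal.obsKernel K u with hI
  have hfm : Measurable f := Proximal.measurable_weightedResidual hh₀.measurable hq₀.measurable
  have hhO : Measurable (fun o : Proximal.Obs dz dw dx => h₀ p a o.2.2.1 o.2.2.2.1) :=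
    hh₀.measurable.comp
      (by fun_prop : Measurable (fun o : Proximal.Obs dz dw dx => (o.2.2.1, o.2.2.2.1)))
  have hpam : Measurable (fun v => p (a, v)) := Proximal.measurable_slice hp.measurable a
  have hpaV : ContinuousAt (fun v => p (a, v)) V :=
    ContinuousAt.comp (f := fun v : Proximal.Rest dz dw dx => (a, v)) (g := p) hpa'
      (by fun_prop)
  have hfV : ContinuousAt f V := by
    have h1 : ContinuousAt (fun v : Proximal.Rest dz dw dx => h₀ p a v.2.1 v.2.2.1) V :=
      ContinuousAt.comp (f := fun v : Proximal.Rest dz dw dx => (v.2.1, v.2.2.1))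
        (g := fun s : (Fin dw → ℝ) × (Fin dx → ℝ) => h₀ p a s.1 s.2) hcont_h (by fun_prop)
    have h2 : ContinuousAt (fun v : Proximal.Rest dz dw dx => q₀ a v.1 v.2.2.1) V :=
      ContinuousAt.comp (f := fun v : Proximal.Rest dz dw dx => (v.1, v.2.2.1))
        (g := fun s : (Fin dz → ℝ) × (Fin dx → ℝ) => q₀ a s.1 s.2) hcont_q (by fun_prop)
    exact (ContinuousAt.sub (by fun_prop) h1).mul h2
  have hhV : ContinuousAt (fun o : Proximal.Obs dz dw dx => h₀ p a o.2.2.1 o.2.2.2.1) (A, V) :=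
    ContinuousAt.comp (f := fun o : Proximal.Obs dz dw dx => (o.2.2.1, o.2.2.2.1))
      (g := fun s : (Fin dw → ℝ) × (Fin dx → ℝ) => h₀ p a s.1 s.2) hcont_h (by fun_prop)
  have hκm : Measurable (Proximal.restKernel K : Proximal.Rest dz dw dx → ℝ) :=
    Proximal.measurable_restKernel hK.measurable
  have hκ1 := Proximal.integral_restKernel (dz := dz) (dw := dw) (dx := dx) hK.integral_eq_one
  have hJlim : Tendsto J (𝓝[>] 0) (𝓝 (f V)) := by
    obtain ⟨B, hB, hdom⟩ := hdom_r
    refine Proximal.tendsto_integral_truncated hfm hκm hpam hfV hpaV hpa hκ1 hB ?_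
    filter_upwards [hdom] with b hb u
    simpa using hb u
  have hIlim : Tendsto I (𝓝[>] 0) (𝓝 (h₀ p a W X)) := by
    obtain ⟨B, hB, hdom⟩ := hdom_h
    refine Proximal.tendsto_integral_truncated
      (g := fun o : Proximal.Obs dz dw dx => h₀ p a o.2.2.1 o.2.2.2.1) (V := (A, V))
      hhO (Proximal.measurable_obsKernel hK.measurable)
      hp.measurable hhV hpO' hpO (Proximal.integral_obsKernel hK.integral_eq_one)
      -- The outcome bridge does not involve the treatment coordinate, so `|K|` in that coordinate
      -- times `B` in the others dominates.
      (hK.integrable.norm.mul_prod hB) ?_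
    filter_upwards [hdom] with b hb u
    have h1 := hb u.2
    simp only [pow_zero, mul_one] at h1
    calc _ = |K u.1| * |h₀ p a (V - b • u.2).2.1 (V - b • u.2).2.2.1 *
          Proximal.restKernel K u.2| := by
          simp only [Proximal.obsKernel, abs_mul]
          rw [mul_left_comm]
          rfl
      _ ≤ _ := mul_le_mul_of_nonneg_left h1 (abs_nonneg _)
  -- Only the error of `J` is multiplied by the possibly divergent kernel value; the error of `I` is
  -- always `o(1)`.
  have hdiff : ∀ b, J b * s b + I b - Proximal.beta h₀ a p -
      (Proximal.kernelDR K (h₀ p a) (q₀ a) a b (A, V) - Proximal.beta h₀ a p) =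
      (J b - f V) * s b + (I b - h₀ p a W X) := fun b => by
    simp only [Proximal.kernelDR, hs, hf, hV]; ring
  have hJ0 : Tendsto (fun b => J b - f V) (𝓝[>] 0) (𝓝 0) := by
    simpa using hJlim.sub_const (f V)
  have hI0 : Tendsto (fun b => I b - h₀ p a W X) (𝓝[>] 0) (𝓝 0) := by
    simpa using hIlim.sub_const (h₀ p a W X)
  refine ⟨fun b => J b * s b + I b - Proximal.beta h₀ a p, ?_, fun L hL => ?_, ?_,
    fun hfd hdom1 => ?_⟩
  · filter_upwards [hsub, hcont, self_mem_nhdsWithin] with b hbsub hbcont hb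
    have hb : 0 < b := hb
    obtain ⟨M, hM, hMp⟩ := Proximal.exists_abs_pertDensity_le hp.nonneg hC (A, V) hb
    have h0 : Proximal.submodel p K (A, V) b 0 = p := by
      ext o; simp [Proximal.submodel]
    have h1 := Proximal.hasDerivWithinAt_integral_bridge hp
      (Proximal.measurable_pertDensity hp.measurable hK.measurable (A, V) b) hM hMp hslice hY
      hoverlap hh₀ hq₀ (k := fun ε => h₀ (Proximal.submodel p K (A, V) b ε) a)
      (by rw [h0]) hbsub hbcont
    rw [Proximal.integral_mul_pertDensity_slice _ _ _ _ hb,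
      Proximal.integral_mul_pertDensity _ _ hb] at h1
    exact h1
  · exact ((hJlim.mul hL).add hIlim).sub_const _
  · simp only [hdiff]
    refine Asymptotics.IsLittleO.add ?_ ?_
    · have h1 : (fun b => J b - f V) =o[𝓝[>] 0] (fun _ => (1 : ℝ)) :=
        (Asymptotics.isLittleO_one_iff ℝ).2 hJ0
      have h2 : s =O[𝓝[>] 0] (fun b => 1 + |s b|) :=
        Asymptotics.IsBigO.of_bound 1 (Eventually.of_forall fun b => by
          rw [one_mul, Real.norm_eq_abs, Real.norm_eq_abs,
            abs_of_nonneg (by positivity : 0 ≤ 1 + |s b|)]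
          linarith)
      simpa using h1.mul_isBigO h2
    · have h1 : (fun b => I b - h₀ p a W X) =o[𝓝[>] 0] (fun _ => (1 : ℝ)) :=
        (Asymptotics.isLittleO_one_iff ℝ).2 hI0
      refine h1.trans_isBigO (Asymptotics.IsBigO.of_bound 1 (Eventually.of_forall fun b => ?_))
      rw [one_mul, Real.norm_eq_abs, Real.norm_eq_abs, abs_one,
        abs_of_nonneg (by positivity : 0 ≤ 1 + |s b|)]
      linarith [abs_nonneg (s b)]
  · simp only [hdiff]
    obtain ⟨B, hB, hdom⟩ := hdom1
    have h1 : Tendsto (fun b => (J b - f V) / b) (𝓝[>] 0) (𝓝 0) := by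
      refine Proximal.tendsto_integral_truncated_sub_div hfm hκm hpam hfd hpaV hpa
        (Proximal.integrable_restKernel hK.integrable) hκ1 (Proximal.restKernel_neg hK.symm)
        (Proximal.integrable_norm_mul_restKernel hK) hB ?_
      simpa only [pow_one] using hdom
    -- The bound `|s b| ≤ C / b` is offset by the rate `J b - f V = o(b)`.
    have h2 : Tendsto (fun b => (J b - f V) * s b) (𝓝[>] 0) (𝓝 0) := by
      refine squeeze_zero_norm' ?_ (by simpa using h1.abs.const_mul C :
        Tendsto (fun b => C * |(J b - f V) / b|) (𝓝[>] 0) (𝓝 0))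
      filter_upwards [self_mem_nhdsWithin] with b hb
      have hb : 0 < b := hb
      rw [Real.norm_eq_abs, abs_mul, abs_div, abs_of_pos hb]
      calc |J b - f V| * |s b| ≤ |J b - f V| * (C / b) := by
            gcongr; exact Proximal.abs_scaled_le hC hb _
        _ = _ := by ring
    simpa using h2.add hI0
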